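/- Conventions. For $n\ge 2$ let $m(n)=\min_{p\mid n} d_p$, where $p$ runs over the primes dividing $n$ and $d_p$ is the largest power of $p$ dividing $n$. A matrix is monomial if each row and each column has exactly one nonzero entry. A nice error basis in dimension $n$ is a set $\{U_g : g\in G\}$ of unitary $n\times n$ matrices indexed by a group $G$ of order $n^2$ such that $U_e=I$, $\operatorname{tr}U_g=0$ for $g\ne e$, and $U_gU_h=\omega(g,h)U_{gh}$ with $|\omega(g,h)|=1$ for all $g,h\in G$. A collection of $\mu$ maximal commuting classes in dimension $n$ is a family $\mathcal C_1,\dots,\mathcal C_\mu$ of sets of unitary $n\times n$ matrices such that each $\mathcal C_k$ consists of $n$ pairwise commuting matrices and contains $I$, $\mathcal C_k\cap\mathcal C_l=\{I\}$ for $k\neq l$, and $\operatorname{tr}(U^\dagger V)=0$ for any two distinct matrices $U,V$ in $\bigcup_k\mathcal C_k$. It corresponds to bases $\mathcal B_1,\dots,\mathcal B_\mu$ of $\mathbb C^n$ if, for each $k$, the vectors of $\mathcal B_k$ are common eigenvectors of the matrices in $\mathcal C_k$. Latin construction. Let $L_1,\dots,L_w$ be mutually orthogonal Latin squares of order $s$,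 and let $H$ be an $s\times s$ matrix that is the character table of an abelian group of order $s$. The $s^2$ cells form a net with $w+2$ parallel classes (the rows, the columns, and for each $k$ the sets of cells on which $L_k$ takes a fixed value), each consisting of $s$ blocks of size $s$. For each parallel class take the $s^2$ vectors of $\mathbb C^{s^2}$ obtained, for each block of the class and each column of $H$, by placing the entries of that column, scaled by $1/\sqrt s$, in the cells of the block (taken in row-by-row order), with $0$ in all other cells. These $w+2$ families of vectors are the Latin bases of $(L_1,\dots,L_w;H)$. Statement. (a) For every $n\ge2$, every collection of maximal commuting classes in dimension $n$ all of whose matrices lie in one nice error basis has at most $m(n)+1$ classes. (b) There are infinitely many $n$ of the form $n=s^2$, $s\ge2$, for which there are mutually orthogonal Latin squares $L_1,\dots,L_w$ of order $s$ with $w+2>m(n)+1$ such that the following holds. Character tables $H$ of abelian groups of order $s$ exist, and for each of them: - the $w+2$ Latin bases of $(L_1,\dots,L_w;H)$ are mutually unbiased orthonormal bases of $\mathbb C^n$; - there is a collection of $w+2$ maximal commuting classes corresponding to them that consists of monomial matrices only; - no collection of $w+2$ maximal commuting classes corresponding to them (in particular no monomial one) can be extended to a nice error basis, i.e. no nice error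 basis in dimension $n$ contains all the matrices of the collection. -/

import Mathlib

open scoped Matrix

noncomputable section

/-- A square matrix is monomial if each row and each column has exactly one nonzero entry. -/
def IsMonomialMatrix {X : Type*} (M : Matrix X X ℂ) : Prop :=
  (∀ i, ∃! j, M i j ≠ 0) ∧ (∀ j, ∃! i, M i j ≠ 0)

/-- A set `N` of `n × n` matrices (`n = |X|`) is a nice error basis: it consists of unitary
matrices `U g`, indexed by a group `G` of order `n ^ 2`, such that `U 1` is the identity, `U g`
has trace `0` for `g ≠ 1`, and `U g * U h = ω(g,h) U (g * h)` with `ω(g,h)` of modulus one. -/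
def IsNiceErrorBasis {X : Type*} [Fintype X] [DecidableEq X] (N : Set (Matrix X X ℂ)) : Prop :=
  ∃ (G : Type) (_ : Group G) (U : G → Matrix X X ℂ),
    Nat.card G = Fintype.card X ^ 2 ∧
    (∀ g, U g ∈ Matrix.unitaryGroup X ℂ) ∧
    U 1 = 1 ∧
    (∀ g, g ≠ 1 → (U g).trace = 0) ∧
    (∀ g h, ∃ ω : ℂ, ‖ω‖ = 1 ∧ U g * U h = ω • U (g * h)) ∧
    N = Set.range U

/-- A collection of maximal commuting classes `C k` of unitary `n × n` matrices (`n = |X|`): each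
class consists of `n` commuting unitary matrices, one of them the identity; distinct classes meet
only in the identity; and all matrices of the collection are mutually orthogonal with respect to
the trace inner product. -/
structure IsMaxCommutingClasses {X κ : Type*} [Fintype X] [DecidableEq X]
    (C : κ → Set (Matrix X X ℂ)) : Prop where
  unitary : ∀ k, ∀ U ∈ C k, U ∈ Matrix.unitaryGroup X ℂ
  one_mem : ∀ k, (1 : Matrix X X ℂ) ∈ C k
  ncard_eq : ∀ k, (C k).ncard = Fintype.card X
  commute : ∀ k, ∀ U ∈ C k, ∀ V ∈ C k, U * V = V * U
  inter_eq : ∀ k l, k ≠ l → C k ∩ C l = {1}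
  orthogonal : ∀ k l, ∀ U ∈ C k, ∀ V ∈ C l, U ≠ V → (Uᴴ * V).trace = 0

/-- A family of mutually unbiased (orthonormal) bases of `ℂ^X`. -/
structure IsMUBCollection {X J κ : Type*} [Fintype X]
    (B : κ → J → EuclideanSpace ℂ X) : Prop where
  orthonormal : ∀ k, Orthonormal ℂ (B k)
  span_eq_top : ∀ k, Submodule.span ℂ (Set.range (B k)) = ⊤
  unbiased : ∀ k l, k ≠ l → ∀ i j,
    ‖inner ℂ (B k i) (B l j)‖ = 1 / Real.sqrt (Fintype.card X)

/-- The classes `C k` correspond to the bases `B k`: the vectors of `B k` are common eigenvectors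
of the matrices in `C k`. -/
def ClassesCorrespond {X J κ : Type*} [Fintype X]
    (C : κ → Set (Matrix X X ℂ)) (B : κ → J → EuclideanSpace ℂ X) : Prop :=
  ∀ k, ∀ U ∈ C k, ∀ j, ∃ c : ℂ, U *ᵥ (B k j).ofLp = c • (B k j).ofLp

/-- The least of the maximal prime powers `d_p` dividing `n`, over the primes `p` dividing `n`
(meaningful for `2 ≤ n`). -/
def minPrimePower (n : ℕ) : ℕ :=
  sInf {d : ℕ | ∃ p : ℕ, p.Prime ∧ p ∣ n ∧ d = p ^ n.factorization p}

/-- `L 0, …, L (w-1)` are mutually orthogonal Latin squares of order `s`. -/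
structure IsMOLS {s w : ℕ} (L : Fin w → Fin s → Fin s → Fin s) : Prop where
  row : ∀ k i, Function.Bijective (fun j => L k i j)
  col : ∀ k j, Function.Bijective (fun i => L k i j)
  orthogonal : ∀ k l, k ≠ l →
    Function.Bijective (fun x : Fin s × Fin s => (L k x.1 x.2, L l x.1 x.2))

/-- The net of a family of `w` Latin squares. Its points are the cells `(i, j)`; it has `w + 2`
parallel classes: the rows, the columns, and one class for each square. `netBlock L c x` is the
label of the block of the class `c` that contains the point `x`. -/
def netBlock {s w : ℕ} (L : Fin w → Fin s → Fin s → Fin s) :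
    Fin 2 ⊕ Fin w → Fin s × Fin s → Fin s
  | .inl 0, x => x.1
  | .inl 1, x => x.2
  | .inr k, x => L k x.1 x.2

/-- The position of a point inside its block of the parallel class `c`, when the points of the
block are listed in the row-by-row order of the cells (see `netPos_lt_iff`, `netPos_bijective`). -/
def netPos {s w : ℕ} : Fin 2 ⊕ Fin w → Fin s × Fin s → Fin s
  | .inl 0, x => x.2
  | .inl 1, x => x.1
  | .inr _, x => x.1

theorem netPos_lt_iff {s w : ℕ} {L : Fin w → Fin s → Fin s → Fin s} (hL : IsMOLS L)
    (c : Fin 2 ⊕ Fin w) (x y : Fin s × Fin s) (h : netBlock L c x = netBlock L c y) :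
    netPos c x < netPos c y ↔ toLex x < toLex y := by
  obtain ⟨a, b⟩ := x
  obtain ⟨a', b'⟩ := y
  rw [Prod.Lex.toLex_lt_toLex]
  match c with
  | .inl 0 => simp_all [netBlock, netPos]
  | .inl 1 => simp_all [netBlock, netPos]
  | .inr k =>
    simp only [netBlock, netPos] at h ⊢
    constructor
    · exact Or.inl
    · rintro (h1 | ⟨h1, h2⟩)
      · exact h1
      · subst h1
        exact absurd ((hL.row k a).1 h) h2.ne

theorem netPos_bijective {s w : ℕ} {L : Fin w → Fin s → Fin s → Fin s} (hL : IsMOLS L)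
    (c : Fin 2 ⊕ Fin w) :
    Function.Bijective (fun x : Fin s × Fin s => (netBlock L c x, netPos c x)) := by
  rw [← Finite.injective_iff_bijective]
  rintro ⟨a, b⟩ ⟨a', b'⟩ h
  match c with
  | .inl 0 => simp_all [netBlock, netPos]
  | .inl 1 => simp_all [netBlock, netPos]
  | .inr k =>
    simp only [netBlock, netPos, Prod.mk.injEq] at h
    obtain ⟨h1, rfl⟩ := h
    rw [(hL.row k a).1 h1]

/-- The Latin MUB construction from the squares `L` and an `s × s` (generalized Hadamard) matrix
`H`: the basis belonging to the parallel class `c` consists of the vectors indexed by `(b, l)`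
obtained by embedding the `l`-th column of `H`, scaled by `1 / √s`, into the positions given by
the incidence vector of the block `b`, and `0` elsewhere. -/
def latinBasis {s w : ℕ} (L : Fin w → Fin s → Fin s → Fin s) (H : Matrix (Fin s) (Fin s) ℂ)
    (c : Fin 2 ⊕ Fin w) (bl : Fin s × Fin s) : EuclideanSpace ℂ (Fin s × Fin s) :=
  WithLp.toLp 2 fun x =>
    if netBlock L c x = bl.1 then H (netPos c x) bl.2 / (Real.sqrt s : ℂ) else 0

/-- `H` is the character table of an abelian group of order `s`
(rows: characters, columns: group elements, each listed in some order). -/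
def IsAbelianCharacterTable {s : ℕ} (H : Matrix (Fin s) (Fin s) ℂ) : Prop :=
  ∃ (A : Type) (_ : CommGroup A) (χ : Fin s ≃ (A →* ℂ)) (a : Fin s ≃ A),
    ∀ i j, H i j = χ i (a j)

end

/-! Part (a) is group theory. At most `n` commuting trace-orthogonal unitaries exist in dimension
`n`, so a class inside a nice error basis is maximal there, and its indices form an abelian subgroup
of order `n` of the index group `G`, which has order `n ^ 2`; different classes give subgroups with
trivial intersection. Let `p ^ d` be the `p`-part of `n` and `P k` a Sylow `p`-subgroup of the
`k`-th subgroup. Any two of the `P k` have a Sylow subgroup of `G` as their product, so they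
permute. Hence every `P k` permutes with one fixed Sylow subgroup `R` (the product of two of them)
and therefore lies in it. Counting nonidentity elements in `R`, of order `p ^ (2 * d)`, leaves room
for at most `p ^ d + 1` subgroups of order `p ^ d` with trivial intersections
(`Subgroup.card_le_of_abelian_of_disjoint`).

Part (b) uses `s = 26 * q` with `q = 6 * t + 1`. As `s` is twice an odd number, `m(s ^ 2) ≤ 4`, yet
there are four mutually orthogonal Latin squares of order `s`: a quasi-difference matrix settles
order 26, lines of an affine plane over `ZMod q` give order `q`, and orthogonal arrays multiply. The
Latin bases have explicit monomial classes, which act by one character on the block labels and by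
translation with another inside the blocks. There are `6 > m(n) + 1` classes, so by part (a) no nice
error basis contains such a collection. -/

/-! ### Abelian subgroups with pairwise trivial intersection. -/

theorem Subgroup.mem_sup_of_permute {G : Type*} [Group G] {P R : Subgroup G}
    (h : ∀ r ∈ R, ∀ x ∈ P, ∃ x' ∈ P, ∃ r' ∈ R, r * x = x' * r') {g : G} (hg : g ∈ P ⊔ R) :
    ∃ x ∈ P, ∃ r ∈ R, g = x * r := by
  rw [Subgroup.sup_eq_closure] at hg
  induction hg using Subgroup.closure_induction with
  | mem x hx =>
    rcases hx with hx | hx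
    · exact ⟨x, hx, 1, R.one_mem, by simp⟩
    · exact ⟨1, P.one_mem, x, hx, by simp⟩
  | one => exact ⟨1, P.one_mem, 1, R.one_mem, by simp⟩
  | mul a b _ _ iha ihb =>
    obtain ⟨x, hx, r, hr, rfl⟩ := iha
    obtain ⟨y, hy, s, hs, rfl⟩ := ihb
    obtain ⟨y', hy', r', hr', e⟩ := h r hr y hy
    refine ⟨x * y', P.mul_mem hx hy', r' * s, R.mul_mem hr' hs, ?_⟩
    calc x * r * (y * s) = x * (r * y) * s := by group
      _ = _ := by rw [e]; group
  | inv a _ iha =>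
    obtain ⟨x, hx, r, hr, rfl⟩ := iha
    obtain ⟨x', hx', r', hr', e⟩ := h _ (R.inv_mem hr) _ (P.inv_mem hx)
    exact ⟨x', hx', r', hr', by rw [mul_inv_rev, e]⟩

/-- Since `K = P * R`, left multiplication by `P` is transitive on the cosets of `R`, and orbits of
a finite `p`-group have `p`-power size. -/
theorem IsPGroup.index_eq_pow_of_mul {K : Type*} [Group K] [Finite K] {p : ℕ} [Fact p.Prime]
    {P R : Subgroup K} (hP : IsPGroup p P) (h : ∀ g : K, ∃ x ∈ P, ∃ r ∈ R, g = x * r) :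
    ∃ n, R.index = p ^ n := by
  obtain ⟨n, hn⟩ := hP.card_orbit ((1 : K) : K ⧸ R)
  refine ⟨n, ?_⟩
  have : MulAction.orbit P ((1 : K) : K ⧸ R) = Set.univ := by
    refine Set.eq_univ_of_forall fun q => ?_
    induction q using QuotientGroup.induction_on with
    | H g =>
      obtain ⟨x, hx, r, hr, rfl⟩ := h g
      refine ⟨⟨x, hx⟩, ?_⟩
      change ((x * 1 : K) : K ⧸ R) = _
      rw [QuotientGroup.eq]
      simpa using hr
  rw [this] at hn
  rw [Subgroup.index, ← hn, Nat.card_univ]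

/-- The join `P ⊔ R` is the product set, in which `R` has `p`-power index; so it is a `p`-group, and
maximality of `R` absorbs `P`. -/
theorem Sylow.le_of_permute {G : Type*} [Group G] [Finite G] {p : ℕ} [Fact p.Prime]
    (R : Sylow p G) {P : Subgroup G} (hP : IsPGroup p P)
    (h : ∀ r ∈ R, ∀ x ∈ P, ∃ x' ∈ P, ∃ r' ∈ R, r * x = x' * r') : P ≤ R := by
  have hidx : ∃ n, ((R : Subgroup G).subgroupOf (P ⊔ R)).index = p ^ n := by
    refine IsPGroup.index_eq_pow_of_mul (P := P.subgroupOf (P ⊔ R)) ?_ ?_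
    · exact hP.comap_of_injective _ (Subgroup.subtype_injective _)
    · rintro ⟨g, hg⟩
      obtain ⟨x, hx, r, hr, rfl⟩ := Subgroup.mem_sup_of_permute (R := (R : Subgroup G)) h hg
      exact ⟨⟨x, (le_sup_left : P ≤ P ⊔ R) hx⟩, hx, ⟨r, (le_sup_right : (R : Subgroup G) ≤ P ⊔ R) hr⟩,
        hr, rfl⟩
  obtain ⟨n, hn⟩ := hidx
  have hK : IsPGroup p ↥(P ⊔ (R : Subgroup G)) := by
    obtain ⟨m, hm⟩ := IsPGroup.iff_card.1 R.isPGroup'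
    refine IsPGroup.of_card (n := m + n) ?_
    rw [← Subgroup.card_mul_index ((R : Subgroup G).subgroupOf (P ⊔ R)), hn, pow_add,
      Nat.card_congr (Subgroup.subgroupOfEquivOfLe le_sup_right).toEquiv]
    exact congrArg (· * p ^ n) hm
  have := R.is_maximal' hK le_sup_right
  exact le_sup_left.trans this.le

/-- Sylow subgroups `S ≥ P` and `T ≥ Q` satisfy `S = (a * b) • T` with `a ∈ A`, `b ∈ B`. Conjugation
by `a` fixes `P` and conjugation by `b` fixes `Q` pointwise, so `b • T` contains both. As `P` and
`Q` meet trivially, their product fills it by cardinality. -/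
theorem Sylow.exists_eq_mul_of_factorization {G : Type*} [Group G] [Finite G] {p d : ℕ}
    [Fact p.Prime] {A B P Q : Subgroup G} (hG : (Nat.card G).factorization p = d + d)
    (hA : ∀ x ∈ A, ∀ y ∈ A, x * y = y * x) (hB : ∀ x ∈ B, ∀ y ∈ B, x * y = y * x)
    (hAB : ∀ g, ∃ a ∈ A, ∃ b ∈ B, g = a * b) (hd : Disjoint A B) (hPA : P ≤ A) (hQB : Q ≤ B)
    (hP : Nat.card P = p ^ d) (hQ : Nat.card Q = p ^ d) :
    ∃ R : Sylow p G, P ≤ R ∧ Q ≤ R ∧ ∀ r ∈ R, ∃ x ∈ P, ∃ y ∈ Q, r = x * y := by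
  obtain ⟨S, hS⟩ := (IsPGroup.of_card hP).exists_le_sylow
  obtain ⟨T, hT⟩ := (IsPGroup.of_card hQ).exists_le_sylow
  obtain ⟨g, rfl⟩ := MulAction.exists_smul_eq G T S
  obtain ⟨a, ha, b, hb, rfl⟩ := hAB g
  have hPR : P ≤ (b • T : Sylow p G) := by
    intro x hx
    have h1 : x ∈ (a • b • T : Sylow p G) := by rw [← mul_smul]; exact hS hx
    have h2 : x = MulAut.conj a x := by
      simp [hA a ha x (hPA hx)]
    rw [h2] at h1
    exact (Subgroup.smul_mem_pointwise_smul_iff (a := MulAut.conj a)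
      (S := ((b • T : Sylow p G) : Subgroup G))).1 h1
  have hQR : Q ≤ (b • T : Sylow p G) := by
    intro x hx
    have h2 : x = MulAut.conj b x := by
      simp [hB b hb x (hQB hx)]
    rw [h2]
    exact (Subgroup.smul_mem_pointwise_smul_iff (a := MulAut.conj b)
      (S := (T : Subgroup G))).2 (hT hx)
  refine ⟨b • T, hPR, hQR, ?_⟩
  let f : P × Q → (b • T : Sylow p G) := fun z =>
    ⟨z.1 * z.2, mul_mem (hPR z.1.2) (hQR z.2.2)⟩
  have hf : Function.Injective f := by
    have hd' : Disjoint P Q := hd.mono hPA hQB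
    exact fun z w h => Subgroup.mul_injective_of_disjoint hd' (congrArg Subtype.val h)
  have hbij : Function.Bijective f := by
    refine (Nat.bijective_iff_injective_and_card f).2 ⟨hf, ?_⟩
    rw [Nat.card_prod, hP, hQ, ← pow_add, ← hG]
    exact (b • T).card_eq_multiplicity.symm
  intro r hr
  obtain ⟨z, hz⟩ := hbij.2 ⟨r, hr⟩
  exact ⟨z.1, z.1.2, z.2, z.2.2, (congrArg Subtype.val hz).symm⟩

theorem Subgroup.exists_mul_of_disjoint_of_card {G : Type*} [Group G] [Finite G] {n : ℕ}
    (hG : Nat.card G = n ^ 2) {A B : Subgroup G} (hA : Nat.card A = n) (hB : Nat.card B = n)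
    (hd : Disjoint A B) (g : G) : ∃ a ∈ A, ∃ b ∈ B, g = a * b := by
  have hbij : Function.Bijective (fun z : A × B => (z.1 * z.2 : G)) := by
    refine (Nat.bijective_iff_injective_and_card _).2 ⟨Subgroup.mul_injective_of_disjoint hd, ?_⟩
    rw [Nat.card_prod, hA, hB, hG, sq]
  obtain ⟨z, hz⟩ := hbij.2 g
  exact ⟨z.1, z.1.2, z.2, z.2.2, hz.symm⟩

/-- Subgroups of order `q` with pairwise trivial intersection in a group of order `q ^ 2`
number at most `q + 1`. -/
theorem Subgroup.card_le_of_pairwise_disjoint {G κ : Type*} [Group G] [Finite G] [Fintype κ]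
    {q : ℕ} (hq : 2 ≤ q) (R : Subgroup G) (hR : Nat.card R = q * q) (P : κ → Subgroup G)
    (hP : ∀ k, Nat.card (P k) = q) (hPR : ∀ k, P k ≤ R)
    (hd : ∀ k l, k ≠ l → Disjoint (P k) (P l)) : Fintype.card κ ≤ q + 1 := by
  classical
  have key : ∀ S : Subgroup G, Nat.card {x : S // x ≠ 1} = Nat.card S - 1 := by
    intro S
    have := Fintype.ofFinite S
    rw [Nat.card_eq_fintype_card, Nat.card_eq_fintype_card, Fintype.card_subtype_compl]
    simp
  -- The sets of nonidentity elements of the `P k` are disjoint in `R`, so their number times `q -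
  -- 1` is at most `q * q - 1 = (q + 1) * (q - 1)`.
  let f : (Σ k, {x : P k // x ≠ 1}) → {x : R // x ≠ 1} := fun z =>
    ⟨⟨z.2.1.1, hPR _ z.2.1.2⟩, fun h => z.2.2 (Subtype.ext (congrArg (fun r : R => (r : G)) h))⟩
  have hf : Function.Injective f := by
    rintro ⟨k, ⟨x, hx⟩, hx1⟩ ⟨l, ⟨y, hy⟩, hy1⟩ h
    have hxy : x = y := congrArg (fun z => z.1.1) h
    subst hxy
    by_cases hkl : k = l
    · subst hkl; rfl
    · exact absurd (Subtype.ext (Subgroup.disjoint_def.1 (hd k l hkl) hx hy)) hx1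
  have := Nat.card_le_card_of_injective f hf
  rw [Nat.card_sigma, key, hR] at this
  simp only [key, hP, Finset.sum_const, Finset.card_univ, smul_eq_mul] at this
  obtain ⟨m, rfl⟩ : ∃ m, q = m + 1 := ⟨q - 1, by omega⟩
  have e : (m + 1) * (m + 1) - 1 = (m + 1 + 1) * m := by
    rw [Nat.sub_eq_iff_eq_add (by nlinarith)]; ring
  rw [e, Nat.add_sub_cancel] at this
  exact Nat.le_of_mul_le_mul_right this (by omega)

/-- A group of order `n ^ 2` has at most `p ^ d + 1` abelian subgroups of order `n` with pairwise
trivial intersection, where `p ^ d` is the largest power of the prime `p` dividing `n`. -/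
theorem Subgroup.card_le_of_abelian_of_disjoint {G κ : Type*} [Group G] [Finite G] [Fintype κ]
    {n p : ℕ} (hn : n ≠ 0) (hp : p.Prime) (hpn : p ∣ n) (hG : Nat.card G = n ^ 2)
    (A : κ → Subgroup G) (hA : ∀ k, Nat.card (A k) = n)
    (hcomm : ∀ k, ∀ x ∈ A k, ∀ y ∈ A k, x * y = y * x)
    (hd : ∀ k l, k ≠ l → Disjoint (A k) (A l)) :
    Fintype.card κ ≤ p ^ n.factorization p + 1 := by
  classical
  have := Fact.mk hp
  rcases le_or_gt (Fintype.card κ) 1 with h1 | h1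
  · omega
  obtain ⟨i, j, hij⟩ := Fintype.one_lt_card_iff.1 h1
  have hP : ∀ k, ∃ P : Subgroup G, P ≤ A k ∧ Nat.card P = p ^ n.factorization p := by
    intro k
    obtain ⟨K, hK⟩ := Sylow.exists_subgroup_card_pow_prime (G := A k) p
      (n := n.factorization p) (by rw [hA]; exact Nat.ordProj_dvd n p)
    refine ⟨K.map (A k).subtype, Subgroup.map_subtype_le K, ?_⟩
    rw [← hK, Subgroup.card_map_of_injective (Subgroup.subtype_injective _)]
  choose P hPA hPc using hP
  have hGf : (Nat.card G).factorization p = n.factorization p + n.factorization p := by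
    rw [hG, Nat.factorization_pow]; simp [two_mul]
  have hpair := fun k l (hkl : k ≠ l) =>
    Sylow.exists_eq_mul_of_factorization hGf (hcomm k) (hcomm l)
      (Subgroup.exists_mul_of_disjoint_of_card hG (hA k) (hA l) (hd k l hkl)) (hd k l hkl)
      (hPA k) (hPA l) (hPc k) (hPc l)
  -- A Sylow subgroup equal to `P l * P k` is closed under products, so it also contains `P k * P
  -- l`.
  have hperm : ∀ k l, k ≠ l → ∀ x ∈ P k, ∀ y ∈ P l, ∃ y' ∈ P l, ∃ x' ∈ P k, x * y = y' * x' := by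
    intro k l hkl x hx y hy
    obtain ⟨R, hR1, hR2, hR3⟩ := hpair l k hkl.symm
    exact hR3 _ (mul_mem (hR2 hx) (hR1 hy))
  obtain ⟨R, hR1, hR2, hR3⟩ := hpair i j hij
  refine Subgroup.card_le_of_pairwise_disjoint (Nat.succ_le_of_lt (Nat.one_lt_pow ?_ hp.one_lt))
    (R : Subgroup G) ?_ P hPc ?_ fun k l hkl => (hd k l hkl).mono (hPA k) (hPA l)
  · exact (hp.factorization_pos_of_dvd hn hpn).ne'
  · rw [Sylow.card_eq_multiplicity, hGf, pow_add]
  · intro k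
    by_cases hki : k = i
    · rw [hki]; exact hR1
    by_cases hkj : k = j
    · rw [hkj]; exact hR2
    -- Here `R = P i * P j`; move `z` leftwards past the factor in `P j`, then past the factor in `P
    -- i`.
    refine R.le_of_permute (IsPGroup.of_card (hPc k)) fun r hr z hz => ?_
    obtain ⟨x, hx, y, hy, rfl⟩ := hR3 r hr
    obtain ⟨z', hz', y', hy', e1⟩ := hperm j k (Ne.symm hkj) y hy z hz
    obtain ⟨z'', hz'', x', hx', e2⟩ := hperm i k (Ne.symm hki) x hx z' hz'
    refine ⟨z'', hz'', x' * y', mul_mem (hR1 hx') (hR2 hy'), ?_⟩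
    rw [mul_assoc, e1, ← mul_assoc, e2, mul_assoc]

/-! ### Commuting trace-orthogonal unitaries. -/

/-- Invariance of `W` under everything that commutes with the family is what drives the induction:
the next operator restricts to `W` and has an eigenvalue there. -/
theorem Module.End.exists_common_eigenspace {ι V : Type*} [AddCommGroup V] [Module ℂ V]
    [FiniteDimensional ℂ V] [Nontrivial V] (f : ι → Module.End ℂ V) (s : Finset ι)
    (hs : ∀ i ∈ s, ∀ j ∈ s, f i * f j = f j * f i) :
    ∃ W : Submodule ℂ V, W ≠ ⊥ ∧ (∀ i ∈ s, ∃ c : ℂ, ∀ w ∈ W, f i w = c • w) ∧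
      ∀ g : Module.End ℂ V, (∀ i ∈ s, f i * g = g * f i) → ∀ w ∈ W, g w ∈ W := by
  classical
  induction s using Finset.induction_on with
  | empty => exact ⟨⊤, top_ne_bot, by simp, by simp⟩
  | insert i s _ ih =>
    obtain ⟨W, hW, hc, hinv⟩ := ih fun i hi j hj =>
      hs i (Finset.mem_insert_of_mem hi) j (Finset.mem_insert_of_mem hj)
    have hi : ∀ w ∈ W, f i w ∈ W := hinv (f i) fun j hj =>
      hs j (Finset.mem_insert_of_mem hj) i (Finset.mem_insert_self i s)
    have := Submodule.nontrivial_iff_ne_bot.2 hW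
    obtain ⟨c, hcv⟩ := Module.End.exists_eigenvalue ((f i).restrict hi)
    obtain ⟨w, hw⟩ := hcv.exists_hasEigenvector
    refine ⟨W ⊓ Module.End.eigenspace (f i) c, ?_, ?_, ?_⟩
    · refine (Submodule.ne_bot_iff _).2 ⟨w, ⟨w.2, ?_⟩, fun h => hw.2 (Subtype.ext h)⟩
      exact Module.End.mem_eigenspace_iff.2 (congrArg Subtype.val hw.apply_eq_smul)
    · intro j hj
      rcases Finset.mem_insert.1 hj with rfl | hj
      · exact ⟨c, fun w hw => Module.End.mem_eigenspace_iff.1 hw.2⟩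
      · obtain ⟨c', hc'⟩ := hc j hj
        exact ⟨c', fun w hw => hc' w hw.1⟩
    · intro g hg w hw
      refine ⟨hinv g (fun j hj => hg j (Finset.mem_insert_of_mem hj)) w hw.1,
        Module.End.mem_eigenspace_iff.2 ?_⟩
      have h1 := LinearMap.congr_fun (hg i (Finset.mem_insert_self i s)) w
      simp only [Module.End.mul_apply] at h1
      rw [h1, Module.End.mem_eigenspace_iff.1 hw.2, map_smul]

theorem Matrix.exists_common_eigenvector {ι X : Type*} [Fintype X] [DecidableEq X] [Nonempty X]
    (U : ι → Matrix X X ℂ) (s : Finset ι) (hs : ∀ i ∈ s, ∀ j ∈ s, U i * U j = U j * U i) :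
    ∃ v : X → ℂ, v ≠ 0 ∧ ∀ i ∈ s, ∃ c : ℂ, U i *ᵥ v = c • v := by
  obtain ⟨W, hW, hc, -⟩ := Module.End.exists_common_eigenspace (fun i => Matrix.toLin' (U i)) s
    fun i hi j hj => by
      simp only [Module.End.mul_eq_comp, ← Matrix.toLin'_mul, hs i hi j hj]
  obtain ⟨v, hv, hv0⟩ := (Submodule.ne_bot_iff _).1 hW
  refine ⟨v, hv0, fun i hi => ?_⟩
  obtain ⟨c, h⟩ := hc i hi
  exact ⟨c, by simpa using h v hv⟩

theorem Matrix.trace_conjTranspose_mul_self_eq {X : Type*} [Fintype X] (M : Matrix X X ℂ) :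
    (Mᴴ * M).trace = ((∑ x, ∑ y, ‖M x y‖ ^ 2 : ℝ) : ℂ) := by
  rw [Finset.sum_comm]
  simp only [Matrix.trace, Matrix.diag, Matrix.mul_apply, Matrix.conjTranspose_apply]
  push_cast
  refine Finset.sum_congr rfl fun x _ => Finset.sum_congr rfl fun y _ => ?_
  exact RCLike.conj_mul _

theorem Matrix.sum_norm_mulVec_sq_le {X : Type*} [Fintype X] (M : Matrix X X ℂ) (v : X → ℂ) :
    ∑ x, ‖(M *ᵥ v) x‖ ^ 2 ≤ (∑ x, ∑ y, ‖M x y‖ ^ 2) * ∑ y, ‖v y‖ ^ 2 := by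
  rw [Finset.sum_mul]
  refine Finset.sum_le_sum fun x _ => ?_
  calc ‖(M *ᵥ v) x‖ ^ 2 ≤ (∑ y, ‖M x y‖ * ‖v y‖) ^ 2 := by
        gcongr
        simp only [Matrix.mulVec, dotProduct]
        exact (norm_sum_le _ _).trans_eq (by simp)
    _ ≤ _ := Finset.sum_mul_sq_le_sq_mul_sq _ _ _

open scoped ComplexOrder in
theorem Matrix.star_mul_self_eigenvalue_of_mem_unitaryGroup {X : Type*} [Fintype X] [DecidableEq X]
    {U : Matrix X X ℂ} (hU : U ∈ Matrix.unitaryGroup X ℂ) {v : X → ℂ} (hv : v ≠ 0) {c : ℂ}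
    (h : U *ᵥ v = c • v) : star c * c = 1 := by
  have h1 : star (U *ᵥ v) ⬝ᵥ (U *ᵥ v) = star v ⬝ᵥ v := by
    rw [Matrix.star_mulVec, ← Matrix.dotProduct_mulVec, Matrix.mulVec_mulVec,
      ← Matrix.star_eq_conjTranspose, (Matrix.mem_unitaryGroup_iff').1 hU, Matrix.one_mulVec]
  rw [h, star_smul, smul_dotProduct, dotProduct_smul, smul_smul, smul_eq_mul] at h1
  have hv0 : star v ⬝ᵥ v ≠ 0 := fun h0 => hv (dotProduct_star_self_eq_zero.1 h0)
  exact mul_right_cancel₀ hv0 (h1.trans (one_mul _).symm)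

/-- Commuting unitary matrices that are orthogonal for the trace inner product number at most the
dimension. -/
theorem Matrix.card_le_of_commute_of_trace_orthogonal {ι X : Type*} [Fintype X] [DecidableEq X]
    [Nonempty X] (U : ι → Matrix X X ℂ) (s : Finset ι)
    (hU : ∀ i ∈ s, U i ∈ Matrix.unitaryGroup X ℂ)
    (hs : ∀ i ∈ s, ∀ j ∈ s, U i * U j = U j * U i)
    (ho : ∀ i ∈ s, ∀ j ∈ s, i ≠ j → ((U i)ᴴ * U j).trace = 0) :
    s.card ≤ Fintype.card X := by
  classical
  rcases s.eq_empty_or_nonempty with rfl | hne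
  · simp
  obtain ⟨v, hv, hc⟩ := Matrix.exists_common_eigenvector U s hs
  choose! c hc using hc
  have hc1 : ∀ i ∈ s, star (c i) * c i = 1 := fun i hi =>
    Matrix.star_mul_self_eigenvalue_of_mem_unitaryGroup (hU i hi) hv (hc i hi)
  -- The weights turn every summand into the identity on the common eigenvector `v`, so `Q` scales
  -- `v` by `s.card`. By orthogonality its squared Frobenius norm is only `s.card * Fintype.card X`,
  -- and it bounds `s.card ^ 2`.
  set Q : Matrix X X ℂ := ∑ i ∈ s, star (c i) • U i with hQ
  have hQv : Q *ᵥ v = (s.card : ℂ) • v := by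
    rw [hQ, Matrix.sum_mulVec, Finset.sum_congr rfl fun i hi => by
      rw [Matrix.smul_mulVec, hc i hi, smul_smul, hc1 i hi, one_smul]]
    simp [Nat.cast_smul_eq_nsmul]
  have hQt : (Qᴴ * Q).trace = s.card * Fintype.card X := by
    rw [hQ, Matrix.conjTranspose_sum, Finset.sum_mul_sum, Matrix.trace_sum]
    have : ∀ i ∈ s, (∑ j ∈ s, (star (c i) • U i)ᴴ * star (c j) • U j).trace
        = Fintype.card X := by
      intro i hi
      rw [Matrix.trace_sum, Finset.sum_eq_single_of_mem i hi]
      · have h1 : (U i)ᴴ * U i = 1 := (Matrix.mem_unitaryGroup_iff').1 (hU i hi)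
        rw [Matrix.conjTranspose_smul, star_star, Matrix.smul_mul, Matrix.mul_smul, smul_smul,
          mul_comm, hc1 i hi, one_smul, h1, Matrix.trace_one]
      · intro j hj hji
        rw [Matrix.conjTranspose_smul, Matrix.smul_mul, Matrix.mul_smul, Matrix.trace_smul,
          Matrix.trace_smul, ho i hi j hj hji.symm, smul_zero, smul_zero]
    rw [Finset.sum_congr rfl this]
    simp
  have hF : (∑ x, ∑ y, ‖Q x y‖ ^ 2 : ℝ) = s.card * Fintype.card X := by
    rw [Matrix.trace_conjTranspose_mul_self_eq] at hQt
    exact_mod_cast hQt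
  have hle := Matrix.sum_norm_mulVec_sq_le Q v
  rw [hF, hQv] at hle
  simp only [Pi.smul_apply, smul_eq_mul, norm_mul, mul_pow, ← Finset.mul_sum] at hle
  have hpos : 0 < ∑ y, ‖v y‖ ^ 2 := by
    obtain ⟨y, hy⟩ := Function.ne_iff.1 hv
    exact Finset.sum_pos' (fun _ _ => by positivity) ⟨y, Finset.mem_univ _, by
      have : v y ≠ 0 := hy
      positivity⟩
  have h2 := le_of_mul_le_mul_right hle hpos
  rw [Complex.norm_natCast, sq] at h2
  exact_mod_cast le_of_mul_le_mul_left h2 (by exact_mod_cast hne.card_pos)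

/-! ### From commuting classes to subgroups of the index group. -/

section NiceErrorBasis

variable {X G : Type} [Fintype X] [DecidableEq X] [Group G] {U : G → Matrix X X ℂ}

theorem trace_conjTranspose_mul_eq_zero_of_ne (hU : ∀ g, U g ∈ Matrix.unitaryGroup X ℂ)
    (htr : ∀ g, g ≠ 1 → (U g).trace = 0)
    (hmul : ∀ g h, ∃ ω : ℂ, ‖ω‖ = 1 ∧ U g * U h = ω • U (g * h)) {g h : G} (hgh : g ≠ h) :
    ((U g)ᴴ * U h).trace = 0 := by
  obtain ⟨ω, hω, e⟩ := hmul g (g⁻¹ * h)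
  have hω0 : ω ≠ 0 := by
    rintro rfl; simp at hω
  rw [mul_inv_cancel_left] at e
  have h1 : (U g)ᴴ * U g = 1 := (Matrix.mem_unitaryGroup_iff').1 (hU g)
  have h2 : U h = ω⁻¹ • (U g * U (g⁻¹ * h)) := by rw [e, smul_smul, inv_mul_cancel₀ hω0, one_smul]
  rw [h2, Matrix.mul_smul, ← mul_assoc, h1, one_mul, Matrix.trace_smul, htr, smul_zero]
  rwa [Ne, inv_mul_eq_one]

/-- Products of members of `C` commute with `C`, so by the bound on commuting families their indices
already belong to it. The subgroup itself is abelian, not merely up to phases, because different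
indices give orthogonal matrices. -/
theorem exists_abelian_subgroup_of_commute [Finite G] [Nonempty X]
    (hU : ∀ g, U g ∈ Matrix.unitaryGroup X ℂ) (hU1 : U 1 = 1)
    (htr : ∀ g, g ≠ 1 → (U g).trace = 0)
    (hmul : ∀ g h, ∃ ω : ℂ, ‖ω‖ = 1 ∧ U g * U h = ω • U (g * h))
    {C : Set (Matrix X X ℂ)} (hC : C ⊆ Set.range U) (h1 : 1 ∈ C)
    (hcard : C.ncard = Fintype.card X) (hcomm : ∀ V ∈ C, ∀ W ∈ C, V * W = W * V) :
    ∃ A : Subgroup G, (∀ g, g ∈ A ↔ U g ∈ C) ∧ Nat.card A = Fintype.card X ∧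
      ∀ x ∈ A, ∀ y ∈ A, x * y = y * x := by
  classical
  have := Fintype.ofFinite G
  have hort := fun {g h : G} (hgh : g ≠ h) => trace_conjTranspose_mul_eq_zero_of_ne hU htr hmul hgh
  have hinj : Function.Injective U := by
    intro g h hgh
    by_contra hne
    have h2 := hort hne
    rw [← hgh, ← Matrix.star_eq_conjTranspose, (Matrix.mem_unitaryGroup_iff').1 (hU g),
      Matrix.trace_one] at h2
    exact Fintype.card_ne_zero (by exact_mod_cast h2)
  have hSc : (U ⁻¹' C).ncard = Fintype.card X := by
    rw [← hcard, Set.ncard_preimage_of_injective_subset_range hinj hC]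
  have hclosed : ∀ g h, U g ∈ C → U h ∈ C → U (g * h) ∈ C := by
    intro g h hg hh
    by_contra hgh
    obtain ⟨ω, hω, e⟩ := hmul g h
    have hω0 : ω ≠ 0 := by
      rintro rfl; simp at hω
    have e2 : U (g * h) = ω⁻¹ • (U g * U h) := by rw [e, smul_smul, inv_mul_cancel₀ hω0, one_smul]
    have hk : ∀ k, U k ∈ C → U (g * h) * U k = U k * U (g * h) := by
      intro k hk
      rw [e2, Matrix.smul_mul, Matrix.mul_smul, mul_assoc, hcomm _ hh _ hk, ← mul_assoc,
        hcomm _ hg _ hk, mul_assoc]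
    -- Adjoining `g * h` would give `n + 1` commuting orthogonal unitaries in dimension `n`.
    have hle := Matrix.card_le_of_commute_of_trace_orthogonal U
      (insert (g * h) (U ⁻¹' C).toFinset) (fun i _ => hU i) (by
        intro i hi j hj
        simp only [Finset.mem_insert, Set.mem_toFinset, Set.mem_preimage] at hi hj
        rcases hi with rfl | hi <;> rcases hj with rfl | hj
        · rfl
        · exact hk j hj
        · exact (hk i hi).symm
        · exact hcomm _ hi _ hj) (fun i _ j _ hij => hort hij)
    rw [Finset.card_insert_of_notMem (by simpa using hgh), ← Set.ncard_eq_toFinset_card', hSc] at hle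
    omega
  let M : Submonoid G :=
    { carrier := U ⁻¹' C
      mul_mem' := fun {a b} ha hb => hclosed a b ha hb
      one_mem' := by simpa [hU1] using h1 }
  let A : Subgroup G :=
    { M with
      inv_mem' := fun {g} hg => by
        -- In a finite group inverses are powers, so closure under products suffices.
        have h3 : g ^ (orderOf g - 1) = g⁻¹ := eq_inv_of_mul_eq_one_left (by
          rw [← pow_succ, Nat.sub_add_cancel (orderOf_pos g), pow_orderOf_eq_one])
        have h4 : g ^ (orderOf g - 1) ∈ M := M.pow_mem hg _
        rw [h3] at h4
        exact h4 }
  refine ⟨A, fun g => Iff.rfl, hSc, fun x hx y hy => ?_⟩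
  obtain ⟨ω, hω, e⟩ := hmul x y
  obtain ⟨ω', hω', e'⟩ := hmul y x
  by_contra hne
  have h5 := hort hne
  have hω0 : ω ≠ 0 := by
    rintro rfl; simp at hω
  have hω'0 : ω' ≠ 0 := by
    rintro rfl; simp at hω'
  -- Nonzero proportional matrices cannot be orthogonal, which excludes `x * y ≠ y * x`.
  have h6 : U (y * x) = (ω'⁻¹ * ω) • U (x * y) := by
    rw [mul_smul, ← e, hcomm _ hx _ hy, e', smul_smul, inv_mul_cancel₀ hω'0, one_smul]
  rw [h6, Matrix.mul_smul, ← Matrix.star_eq_conjTranspose,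
    (Matrix.mem_unitaryGroup_iff').1 (hU _), Matrix.trace_smul, Matrix.trace_one, smul_eq_mul] at h5
  simp [hω0, hω'0] at h5

end NiceErrorBasis

theorem IsMaxCommutingClasses.card_le_of_subset_niceErrorBasis {X : Type} [Fintype X]
    [DecidableEq X] (hX : 2 ≤ Fintype.card X) {N : Set (Matrix X X ℂ)} (hN : IsNiceErrorBasis N)
    {κ : Type*} [Fintype κ] {C : κ → Set (Matrix X X ℂ)} (hC : IsMaxCommutingClasses C)
    (hCN : ∀ k, C k ⊆ N) : Fintype.card κ ≤ minPrimePower (Fintype.card X) + 1 := by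
  obtain ⟨G, _, U, hG, hU, hU1, htr, hmul, rfl⟩ := hN
  have : Finite G := Nat.finite_of_card_ne_zero (by rw [hG]; positivity)
  have : Nonempty X := Fintype.card_pos_iff.1 (by omega)
  choose A hA hAc hAcomm using fun k => exists_abelian_subgroup_of_commute hU hU1 htr hmul
    (hCN k) (hC.one_mem k) (hC.ncard_eq k) (hC.commute k)
  have hd : ∀ k l, k ≠ l → Disjoint (A k) (A l) := by
    intro k l hkl
    refine Subgroup.disjoint_def.2 fun {g} hg hg' => ?_
    by_contra hne
    have h1 : U g ∈ C k ∩ C l := ⟨(hA k g).1 hg, (hA l g).1 hg'⟩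
    rw [hC.inter_eq k l hkl, Set.mem_singleton_iff] at h1
    have h2 := htr g hne
    rw [h1, Matrix.trace_one] at h2
    exact Fintype.card_ne_zero (by exact_mod_cast h2)
  have hne : {d : ℕ | ∃ p : ℕ, p.Prime ∧ p ∣ Fintype.card X ∧
      d = p ^ (Fintype.card X).factorization p}.Nonempty := by
    obtain ⟨p, hp, hpd⟩ := Nat.exists_prime_and_dvd (n := Fintype.card X) (by omega)
    exact ⟨_, p, hp, hpd, rfl⟩
  obtain ⟨p, hp, hpd, e⟩ := Nat.sInf_mem hne
  rw [minPrimePower, e]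
  exact Subgroup.card_le_of_abelian_of_disjoint (by omega) hp hpd hG A hAc hAcomm hd

/-! ### Orthogonal arrays and Latin squares. -/

/-- The map `f` lists the rows of an orthogonal array of strength two and index one: any two
columns together determine the row, and every pair of entries occurs. -/
def IsOrthogonalArray {X ι V : Type*} (f : X → ι → V) : Prop :=
  ∀ a b, a ≠ b → Function.Bijective fun x => (f x a, f x b)

theorem IsOrthogonalArray.of_injective {X ι V : Type*} [Fintype X] [Fintype V] {f : X → ι → V}
    (hc : Fintype.card X = Fintype.card V * Fintype.card V)
    (h : ∀ a b, a ≠ b → ∀ x y, f x a = f y a → f x b = f y b → x = y) : IsOrthogonalArray f :=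
  fun a b hab => (Fintype.bijective_iff_injective_and_card _).2
    ⟨fun x y hxy => h a b hab x y (congrArg Prod.fst hxy) (congrArg Prod.snd hxy),
      by rw [hc, Fintype.card_prod]⟩

theorem IsOrthogonalArray.prod {X Y ι V W : Type*} {f : X → ι → V} {g : Y → ι → W}
    (hf : IsOrthogonalArray f) (hg : IsOrthogonalArray g) :
    IsOrthogonalArray fun (x : X × Y) a => (f x.1 a, g x.2 a) := by
  intro a b hab
  refine ⟨fun x y hxy => ?_, fun v => ?_⟩
  · simp only [Prod.mk.injEq] at hxy
    exact Prod.ext ((hf a b hab).1 (Prod.ext hxy.1.1 hxy.2.1))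
      ((hg a b hab).1 (Prod.ext hxy.1.2 hxy.2.2))
  · obtain ⟨x, hx⟩ := (hf a b hab).2 (v.1.1, v.2.1)
    obtain ⟨y, hy⟩ := (hg a b hab).2 (v.1.2, v.2.2)
    simp only [Prod.mk.injEq] at hx hy
    exact ⟨(x, y), Prod.ext (Prod.ext hx.1 hy.1) (Prod.ext hx.2 hy.2)⟩

theorem IsOrthogonalArray.comp_equiv {X ι V W : Type*} {f : X → ι → V}
    (hf : IsOrthogonalArray f) (e : V ≃ W) : IsOrthogonalArray fun x a => e (f x a) :=
  fun a b hab => (Equiv.prodCongr e e).bijective.comp (hf a b hab)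

/-- Columns `0` and `1` serve as coordinates of the cells; each remaining column is then a Latin
square. -/
theorem IsOrthogonalArray.exists_isMOLS {X : Type*} {s w : ℕ} {f : X → Fin (w + 2) → Fin s}
    (hf : IsOrthogonalArray f) : ∃ L : Fin w → Fin s → Fin s → Fin s, IsMOLS L := by
  let e := Equiv.ofBijective _ (hf 0 1 (by simp))
  have h0 : ∀ z, f (e.symm z) 0 = z.1 := fun z => congrArg Prod.fst (e.apply_symm_apply z)
  have h1 : ∀ z, f (e.symm z) 1 = z.2 := fun z => congrArg Prod.snd (e.apply_symm_apply z)
  have hne0 : ∀ k : Fin w, (0 : Fin (w + 2)) ≠ k.succ.succ := fun k => (Fin.succ_ne_zero _).symm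
  have hne1 : ∀ k : Fin w, (1 : Fin (w + 2)) ≠ k.succ.succ := fun k h =>
    Fin.succ_ne_zero k (Fin.succ_injective _ (h.symm.trans (Fin.succ_zero_eq_one).symm))
  refine ⟨fun k i j => f (e.symm (i, j)) k.succ.succ, fun k i => ?_, fun k j => ?_,
    fun k l hkl => ?_⟩
  · refine Finite.injective_iff_bijective.1 fun j j' h => ?_
    have h2 := (hf _ _ (hne0 k)).1 (Prod.ext ((h0 (i, j)).trans (h0 (i, j')).symm) h)
    exact congrArg Prod.snd (e.symm.injective h2)
  · refine Finite.injective_iff_bijective.1 fun i i' h => ?_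
    have h2 := (hf _ _ (hne1 k)).1 (Prod.ext ((h1 (i, j)).trans (h1 (i', j)).symm) h)
    exact congrArg Prod.fst (e.symm.injective h2)
  · exact (hf _ _ fun h => hkl (Fin.succ_injective _ (Fin.succ_injective _ h))).comp
      e.symm.bijective

/-- The array of the lines of slopes `0, …, 4` and of the vertical lines of the affine plane
over `ZMod q`. -/
def linearArray (q : ℕ) (x : ZMod q × ZMod q) (a : Fin 6) : ZMod q :=
  if a = 5 then x.1 else x.2 + (a.val : ZMod q) * x.1

/-- Two lines of different slopes meet in one point as soon as the difference of the slopes, at most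
`4`, is a unit modulo `q`. -/
theorem linearArray_isOrthogonalArray (q : ℕ) [NeZero q]
    (hq : ∀ k, 0 < k → k < 5 → k.Coprime q) : IsOrthogonalArray (linearArray q) := by
  refine IsOrthogonalArray.of_injective (Fintype.card_prod _ _) ?_
  have key : ∀ a b : Fin 6, a < b → ∀ x y : ZMod q × ZMod q,
      linearArray q x a = linearArray q y a → linearArray q x b = linearArray q y b → x = y := by
    intro a b hab x y h1 h2
    have ha : a ≠ 5 := fun h => by subst h; exact absurd hab (by omega)
    simp only [linearArray, if_neg ha] at h1
    have h3 : x.1 = y.1 := by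
      by_cases hb : b = 5
      · simpa [linearArray, hb] using h2
      · simp only [linearArray, if_neg hb] at h2
        obtain ⟨k, hk⟩ := Nat.exists_eq_add_of_lt (Fin.lt_def.1 hab)
        have hu : IsUnit ((k + 1 : ℕ) : ZMod q) :=
          (ZMod.isUnit_iff_coprime _ _).2 (hq _ (by omega) (by omega))
        refine hu.mul_left_cancel ?_
        rw [hk] at h2
        push_cast at h2 ⊢
        linear_combination h2 - h1
    rw [h3] at h1
    exact Prod.ext h3 (add_right_cancel h1)
  intro a b hab x y h1 h2
  rcases lt_or_gt_of_ne hab with h | h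
  · exact key a b h x y h1 h2
  · exact key b a h x y h2 h1

/-! ### Four mutually orthogonal Latin squares of order `26 * q`. -/

/-- A `(21, 6; 1, 1; 5)` quasi-difference matrix: the column `none` is zero, and the column
`some (r, c)` is the `r`-th of five base columns, shifted cyclically by `c`. The entry `Sum.inr r`
stands for the empty entry of the shifts of the `r`-th base column. -/
def quasiDifferenceMatrix : Option (Fin 5 × Fin 6) → Fin 6 → ZMod 21 ⊕ ZMod 5
  | none, _ => .inl 0
  | some (r, c), a =>
    if a = c then .inr r else
      .inl ((![![0, 0, 1, 3, 6, 4], ![0, 0, 6, 11, 10, 19], ![0, 0, 7, 20, 14, 5],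
        ![0, 0, 8, 18, 1, 12], ![0, 0, 14, 10, 5, 2]] : Fin 5 → Fin 6 → ZMod 21) r (a - c))

/-- The difference of two entries of a column, where both entries are nonempty. -/
def quasiDifference (a b : Fin 6) (c : Option (Fin 5 × Fin 6)) : Option (ZMod 21) :=
  match quasiDifferenceMatrix c a, quasiDifferenceMatrix c b with
  | .inl d, .inl e => some (d - e)
  | _, _ => none

/-- For given `a ≠ b`, ten of the 31 columns have an empty entry at `a` or `b`; the other 21 have
distinct differences, so each element of `ZMod 21` occurs once. This is a finite check. -/
theorem quasiDifference_inj : ∀ a b, a ≠ b → ∀ c c', quasiDifference a b c ≠ none →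
    quasiDifference a b c = quasiDifference a b c' → c = c' := by
  decide +kernel

theorem quasiDifferenceMatrix_inr_inj : ∀ a r c c', quasiDifferenceMatrix c a = .inr r →
    quasiDifferenceMatrix c' a = .inr r → c = c' := by
  decide +kernel

theorem quasiDifferenceMatrix_not_inr : ∀ a b, a ≠ b → ∀ c r r',
    quasiDifferenceMatrix c a = .inr r → quasiDifferenceMatrix c b ≠ .inr r' := by
  decide +kernel

/-- The array with `26` symbols obtained by developing the quasi-difference matrix and filling the
hole with an array on `5` symbols. -/
def array26 : (Option (Fin 5 × Fin 6) × ZMod 21) ⊕ (ZMod 5 × ZMod 5) → Fin 6 → ZMod 21 ⊕ ZMod 5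
  | .inl x, a => (quasiDifferenceMatrix x.1 a).map (· + x.2) id
  | .inr y, a => .inr (linearArray 5 y a)

theorem array26_isOrthogonalArray : IsOrthogonalArray array26 := by
  have hmix : ∀ a b, a ≠ b → ∀ x y, array26 (.inl x) a = array26 (.inr y) a →
      array26 (.inl x) b = array26 (.inr y) b → False := by
    intro a b hab x y h1 h2
    simp only [array26] at h1 h2
    rcases ha : quasiDifferenceMatrix x.1 a with d | r
    · simp [ha] at h1
    rcases hb : quasiDifferenceMatrix x.1 b with e | r'
    · simp [hb] at h2
    exact quasiDifferenceMatrix_not_inr a b hab _ _ _ ha hb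
  have h5 : IsOrthogonalArray (linearArray 5) :=
    linearArray_isOrthogonalArray 5 fun k h1 h2 => by interval_cases k <;> norm_num
  -- The count is `31 * 21 + 5 * 5 = 26 * 26`.
  refine IsOrthogonalArray.of_injective (by simp [ZMod.card]) ?_
  rintro a b hab (⟨c, t⟩ | x) (⟨c', t'⟩ | y) h1 h2
  · simp only [array26] at h1 h2
    have hcc : c = c' := by
      rcases ha : quasiDifferenceMatrix c a with d | r <;>
        rcases ha' : quasiDifferenceMatrix c' a with d' | r' <;>
        simp only [ha, ha', Sum.map_inl, Sum.map_inr, Sum.inl.injEq, Sum.inr.injEq, id,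
          reduceCtorEq] at h1
      · rcases hb : quasiDifferenceMatrix c b with e | r <;>
          rcases hb' : quasiDifferenceMatrix c' b with e' | r' <;>
          simp only [hb, hb', Sum.map_inl, Sum.map_inr, Sum.inl.injEq, Sum.inr.injEq, id,
            reduceCtorEq] at h2
        · refine quasiDifference_inj a b hab c c' (by simp [quasiDifference, ha, hb]) ?_
          simp only [quasiDifference, ha, hb, ha', hb', Option.some.injEq]
          linear_combination h1 - h2
        · exact quasiDifferenceMatrix_inr_inj b _ _ _ hb (h2 ▸ hb')
      · exact quasiDifferenceMatrix_inr_inj a _ _ _ ha (h1 ▸ ha')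
    subst hcc
    rcases ha : quasiDifferenceMatrix c a with d | r
    · simp [ha] at h1
      rw [h1]
    rcases hb : quasiDifferenceMatrix c b with e | r'
    · simp [hb] at h2
      rw [h2]
    exact absurd hb (quasiDifferenceMatrix_not_inr a b hab _ _ _ ha)
  · exact (hmix a b hab _ _ h1 h2).elim
  · exact (hmix a b hab _ _ h1.symm h2.symm).elim
  · rw [(h5 a b hab).1 (Prod.ext (Sum.inr_injective h1) (Sum.inr_injective h2))]

theorem exists_isMOLS_four (q : ℕ) [NeZero q] (hq : ∀ k, 0 < k → k < 5 → k.Coprime q) :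
    ∃ L : Fin 4 → Fin (26 * q) → Fin (26 * q) → Fin (26 * q), IsMOLS L := by
  have e : (ZMod 21 ⊕ ZMod 5) × ZMod q ≃ Fin (26 * q) :=
    Fintype.equivFinOfCardEq (by simp [ZMod.card])
  exact ((array26_isOrthogonalArray.prod (linearArray_isOrthogonalArray q hq)).comp_equiv
    e).exists_isMOLS

/-! ### The bound on `m(n)`. -/

theorem minPrimePower_le {n p : ℕ} (hp : p.Prime) (hpn : p ∣ n) :
    minPrimePower n ≤ p ^ n.factorization p :=
  Nat.sInf_le ⟨p, hp, hpn, rfl⟩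

theorem minPrimePower_sq_le_four (t : ℕ) : minPrimePower ((26 * (6 * t + 1)) ^ 2) ≤ 4 := by
  refine (minPrimePower_le Nat.prime_two (by rw [sq, mul_assoc]; omega)).trans ?_
  have h : (26 * (6 * t + 1)).factorization 2 = 1 := by
    rw [show 26 * (6 * t + 1) = 2 * (13 * (6 * t + 1)) by ring,
      Nat.factorization_mul (by norm_num) (by positivity), Finsupp.add_apply,
      Nat.prime_two.factorization_self, Nat.factorization_eq_zero_of_not_dvd (by omega)]
  rw [Nat.factorization_pow, Finsupp.smul_apply, h]
  norm_num

/-! ### Character tables -/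

/-- The properties of the character table `H` of an abelian group of order `s` that the
construction uses: row `i₀` is the trivial character, and row `σ i k` is the product of the rows
`i` and `k`. -/
structure IsCharacterTableWith {s : ℕ} (H : Matrix (Fin s) (Fin s) ℂ) (i₀ : Fin s)
    (σ : Fin s → Fin s → Fin s) : Prop where
  star_mul_self : ∀ i j, star (H i j) * H i j = 1
  row_orthogonal : ∀ i k, i ≠ k → ∑ j, star (H i j) * H k j = 0
  trivial_row : ∀ j, H i₀ j = 1
  mul_row : ∀ i k j, H (σ i k) j = H i j * H k j

theorem MonoidHom.norm_eq_one_of_finite {A : Type*} [Group A] [Finite A] (χ : A →* ℂ) (a : A) :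
    ‖χ a‖ = 1 := by
  refine Complex.norm_eq_one_of_pow_eq_one (n := Nat.card A) ?_ Nat.card_pos.ne'
  rw [← map_pow, pow_card_eq_one', map_one]

theorem MonoidHom.star_mul_self_of_finite {A : Type*} [Group A] [Finite A] (χ : A →* ℂ) (a : A) :
    star (χ a) * χ a = 1 := by
  have h : star (χ a) * χ a = ((‖χ a‖ : ℂ)) ^ 2 := RCLike.conj_mul _
  rw [h, χ.norm_eq_one_of_finite]
  simp

theorem MonoidHom.sum_star_mul_eq_zero {A : Type*} [CommGroup A] [Fintype A] {χ ψ : A →* ℂ}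
    (h : χ ≠ ψ) : ∑ a, star (χ a) * ψ a = 0 := by
  let φ : A →* ℂ :=
    { toFun := fun a => star (χ a) * ψ a
      map_one' := by simp
      map_mul' := fun a b => by simp only [map_mul, star_mul]; ring }
  refine sum_hom_units_eq_zero φ fun hφ => h (MonoidHom.ext fun a => ?_)
  have h1 : star (χ a) * ψ a = 1 := DFunLike.congr_fun hφ a
  have h2 := χ.star_mul_self_of_finite a
  exact mul_left_cancel₀ (left_ne_zero_of_mul_eq_one h2) (h2.trans h1.symm)

theorem IsAbelianCharacterTable.exists_isCharacterTableWith {s : ℕ}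
    {H : Matrix (Fin s) (Fin s) ℂ} (hH : IsAbelianCharacterTable H) :
    ∃ i₀ σ, IsCharacterTableWith H i₀ σ := by
  obtain ⟨A, _, χ, a, h⟩ := hH
  have : Fintype A := Fintype.ofEquiv _ a
  refine ⟨χ.symm 1, fun i k => χ.symm (χ i * χ k), fun i j => ?_, fun i k hik => ?_,
    fun j => ?_, fun i k j => ?_⟩
  · rw [h, MonoidHom.star_mul_self_of_finite]
  · simp only [h]
    rw [Equiv.sum_comp a fun x => star (χ i x) * χ k x]
    exact MonoidHom.sum_star_mul_eq_zero (χ.injective.ne hik)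
  · simp [h]
  · simp [h]

/-- The cyclic group of order `s` has exactly `s` complex characters, since `ℂ` has enough roots of
unity. -/
theorem exists_isAbelianCharacterTable (s : ℕ) [NeZero s] :
    ∃ H : Matrix (Fin s) (Fin s) ℂ, IsAbelianCharacterTable H := by
  let A := Multiplicative (ZMod s)
  have hA : Nat.card A = s := by simp [A]
  have a : Fin s ≃ A := (Finite.equivFinOfCardEq hA).symm
  have hχ : Nat.card (A →* ℂ) = s := by
    have e : (A →* ℂˣ) ≃ (A →* ℂ) :=
      { toFun := fun f => (Units.coeHom ℂ).comp f
        invFun := fun f => f.toHomUnits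
        left_inv := fun f => by ext; rfl
        right_inv := fun f => by ext; rfl }
    rw [← Nat.card_congr e, CommGroup.card_monoidHom_of_hasEnoughRootsOfUnity, hA]
  have : Finite (A →* ℂ) := Nat.finite_of_card_ne_zero (hχ.trans_ne (NeZero.ne s))
  have χ : Fin s ≃ (A →* ℂ) := (Finite.equivFinOfCardEq hχ).symm
  exact ⟨fun i j => χ i (a j), A, inferInstance, χ, a, fun _ _ => rfl⟩

namespace IsCharacterTableWith

variable {s : ℕ} {H : Matrix (Fin s) (Fin s) ℂ} {i₀ : Fin s} {σ : Fin s → Fin s → Fin s}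

theorem norm_eq_one (h : IsCharacterTableWith H i₀ σ) (i j : Fin s) : ‖H i j‖ = 1 := by
  have h1 := congrArg norm (h.star_mul_self i j)
  rw [norm_mul, norm_star, norm_one] at h1
  nlinarith [norm_nonneg (H i j)]

theorem ne_zero (h : IsCharacterTableWith H i₀ σ) (i j : Fin s) : H i j ≠ 0 :=
  right_ne_zero_of_mul_eq_one (h.star_mul_self i j)

theorem row_injective (h : IsCharacterTableWith H i₀ σ) {i k : Fin s}
    (hik : ∀ j, H i j = H k j) : i = k := by
  by_contra hne
  have h1 := h.row_orthogonal i k hne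
  simp only [← hik, h.star_mul_self, Finset.sum_const, Finset.card_univ, Fintype.card_fin,
    nsmul_eq_mul, mul_one, Nat.cast_eq_zero] at h1
  exact (Fin.pos i).ne' h1

theorem mul_injective (h : IsCharacterTableWith H i₀ σ) (i : Fin s) :
    Function.Injective (σ i) := fun k k' hk => h.row_injective fun j => by
  have h1 := h.mul_row i k j
  rw [hk, h.mul_row] at h1
  exact (mul_left_cancel₀ (h.ne_zero i j) h1).symm

theorem mul_left_injective (h : IsCharacterTableWith H i₀ σ) {i i' k : Fin s}
    (hk : σ i k = σ i' k) : i = i' := h.row_injective fun j => by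
  have h1 := h.mul_row i k j
  rw [hk, h.mul_row] at h1
  exact (mul_right_cancel₀ (h.ne_zero k j) h1).symm

theorem trivial_mul (h : IsCharacterTableWith H i₀ σ) (k : Fin s) : σ i₀ k = k :=
  h.row_injective fun j => by rw [h.mul_row, h.trivial_row, one_mul]

theorem mul_left_comm (h : IsCharacterTableWith H i₀ σ) (i i' k : Fin s) :
    σ i (σ i' k) = σ i' (σ i k) :=
  h.row_injective fun j => by simp only [h.mul_row]; ring

theorem sum_eq_zero (h : IsCharacterTableWith H i₀ σ) {i : Fin s} (hi : i ≠ i₀) :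
    ∑ j, H i j = 0 := by
  have := h.row_orthogonal i₀ i hi.symm
  simpa [h.trivial_row] using this

/-- Row orthogonality says that `s⁻¹ • Hᴴ` is a right inverse of `H`; for square matrices it is also
a left inverse. -/
theorem column_orthogonal (h : IsCharacterTableWith H i₀ σ) (j k : Fin s) :
    ∑ i, star (H i j) * H i k = if j = k then (s : ℂ) else 0 := by
  have hs : (s : ℂ) ≠ 0 := Nat.cast_ne_zero.2 (Fin.pos i₀).ne'
  have h1 : H * ((s : ℂ)⁻¹ • Hᴴ) = 1 := by
    ext i i'
    rw [Matrix.mul_smul, Matrix.smul_apply, Matrix.mul_apply, Matrix.one_apply]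
    simp only [Matrix.conjTranspose_apply]
    split_ifs with hii
    · subst hii
      simp only [mul_comm (H i _), h.star_mul_self]
      simp [hs]
    · simp only [mul_comm (H i _), h.row_orthogonal i' i (Ne.symm hii), smul_zero]
  have h2 := mul_eq_one_comm.1 h1
  have h3 := congrFun (congrFun h2 j) k
  rw [Matrix.smul_mul, Matrix.smul_apply, Matrix.mul_apply, Matrix.one_apply, smul_eq_mul] at h3
  simp only [Matrix.conjTranspose_apply] at h3
  rw [inv_mul_eq_iff_eq_mul₀ hs] at h3
  rw [h3]
  split_ifs <;> simp

end IsCharacterTableWith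

/-! ### Monomial matrices -/

/-- The monomial matrix whose nonzero entry in row `x` is `d x`, in column `τ x`. -/
def monomialMatrix {X : Type*} [DecidableEq X] (τ : Equiv.Perm X) (d : X → ℂ) : Matrix X X ℂ :=
  fun x y => if y = τ x then d x else 0

theorem isMonomialMatrix_monomialMatrix {X : Type*} [DecidableEq X] (τ : Equiv.Perm X) {d : X → ℂ} (hd : ∀ x, d x ≠ 0) :
    IsMonomialMatrix (monomialMatrix τ d) := by
  refine ⟨fun x => ⟨τ x, by simp [monomialMatrix, hd], fun y hy => ?_⟩,
    fun y => ⟨τ.symm y, by simp [monomialMatrix, hd], fun x hx => ?_⟩⟩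
  · by_contra h
    simp [monomialMatrix, h] at hy
  · by_contra h
    refine hx (if_neg fun h' => h ?_)
    rw [h', Equiv.symm_apply_apply]

section Monomial

variable {X : Type*} [Fintype X] [DecidableEq X] (τ τ' : Equiv.Perm X) (d d' : X → ℂ)

theorem monomialMatrix_mulVec (v : X → ℂ) (x : X) :
    (monomialMatrix τ d *ᵥ v) x = d x * v (τ x) := by
  simp [monomialMatrix, Matrix.mulVec, dotProduct]

theorem monomialMatrix_mul :
    monomialMatrix τ d * monomialMatrix τ' d' =
      monomialMatrix (τ.trans τ') fun x => d x * d' (τ x) := by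
  ext x y
  rw [Matrix.mul_apply, Finset.sum_eq_single (τ x)]
  · simp [monomialMatrix]
    rfl
  · intro z _ hz
    simp [monomialMatrix, hz]
  · simp

theorem monomialMatrix_trace_conjTranspose_mul :
    ((monomialMatrix τ d)ᴴ * monomialMatrix τ' d').trace =
      ∑ x, if τ x = τ' x then star (d x) * d' x else 0 := by
  simp only [Matrix.trace, Matrix.diag, Matrix.mul_apply, Matrix.conjTranspose_apply]
  rw [Finset.sum_comm]
  refine Finset.sum_congr rfl fun x _ => ?_
  rw [Finset.sum_eq_single (τ x)]
  · simp [monomialMatrix]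
  · intro y _ hy
    simp [monomialMatrix, hy]
  · simp

theorem monomialMatrix_mem_unitaryGroup {d : X → ℂ} (hd : ∀ x, star (d x) * d x = 1) :
    monomialMatrix τ d ∈ Matrix.unitaryGroup X ℂ := by
  rw [Matrix.mem_unitaryGroup_iff]
  ext x z
  rw [Matrix.star_eq_conjTranspose, Matrix.mul_apply, Matrix.one_apply,
    Finset.sum_eq_single (τ x)]
  · by_cases hxz : x = z
    · subst hxz
      simp only [Matrix.conjTranspose_apply, monomialMatrix, if_true]
      rw [mul_comm, hd]
    · simp [monomialMatrix, hxz]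
  · intro y _ hy
    simp [monomialMatrix, hy]
  · simp

end Monomial

/-! ### Latin bases -/

section Latin

variable {s w : ℕ} {L : Fin w → Fin s → Fin s → Fin s} {H : Matrix (Fin s) (Fin s) ℂ} {i₀ : Fin s}
  {σ : Fin s → Fin s → Fin s}

theorem netBlock_bijective (hL : IsMOLS L) {c d : Fin 2 ⊕ Fin w} (hcd : c ≠ d) :
    Function.Bijective fun x => (netBlock L c x, netBlock L d x) := by
  rw [← Finite.injective_iff_bijective]
  rintro ⟨a, b⟩ ⟨a', b'⟩ h
  rw [Prod.mk.injEq] at h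
  match c, d with
  | .inl 0, .inl 0 => exact absurd rfl hcd
  | .inl 0, .inl 1 => exact Prod.ext h.1 h.2
  | .inl 1, .inl 0 => exact Prod.ext h.2 h.1
  | .inl 1, .inl 1 => exact absurd rfl hcd
  | .inl 0, .inr k =>
    obtain ⟨rfl, h2⟩ : a = a' ∧ L k a b = L k a' b' := h
    rw [(hL.row k a).1 h2]
  | .inl 1, .inr k =>
    obtain ⟨rfl, h2⟩ : b = b' ∧ L k a b = L k a' b' := h
    rw [(hL.col k b).1 h2]
  | .inr k, .inl 0 =>
    obtain ⟨h2, rfl⟩ : L k a b = L k a' b' ∧ a = a' := h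
    rw [(hL.row k a).1 h2]
  | .inr k, .inl 1 =>
    obtain ⟨h2, rfl⟩ : L k a b = L k a' b' ∧ b = b' := h
    rw [(hL.col k b).1 h2]
  | .inr k, .inr l =>
    exact (hL.orthogonal k l fun e => hcd (by rw [e])).1 (Prod.ext h.1 h.2)

theorem inner_latinBasis (c d : Fin 2 ⊕ Fin w) (u v : Fin s × Fin s) :
    inner ℂ (latinBasis L H c u) (latinBasis L H d v) =
      ∑ x, if netBlock L c x = u.1 ∧ netBlock L d x = v.1 then
        star (H (netPos c x) u.2) * H (netPos d x) v.2 / s else 0 := by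
  have hs : (Real.sqrt s : ℂ) * Real.sqrt s = s := by
    rw [← Complex.ofReal_mul, Real.mul_self_sqrt (Nat.cast_nonneg s), Complex.ofReal_natCast]
  rw [PiLp.inner_apply]
  refine Finset.sum_congr rfl fun x _ => ?_
  rw [RCLike.inner_apply]
  by_cases h1 : netBlock L c x = u.1 <;> by_cases h2 : netBlock L d x = v.1 <;>
    simp only [latinBasis, h1, h2, if_true, if_false, map_zero, mul_zero, zero_mul, and_true,
      and_false]
  rw [map_div₀, Complex.conj_ofReal, ← hs, div_mul_div_comm, mul_comm (H _ _)]
  rfl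

theorem latinBasis_orthonormal (hL : IsMOLS L) (hH : IsCharacterTableWith H i₀ σ)
    (c : Fin 2 ⊕ Fin w) : Orthonormal ℂ (latinBasis L H c) := by
  have hs : (s : ℂ) ≠ 0 := Nat.cast_ne_zero.2 (Fin.pos i₀).ne'
  rw [orthonormal_iff_ite]
  intro u v
  rw [inner_latinBasis, (netPos_bijective hL c).sum_comp fun z : Fin s × Fin s =>
    if z.1 = u.1 ∧ z.1 = v.1 then star (H z.2 u.2) * H z.2 v.2 / s else 0,
    Fintype.sum_prod_type]
  by_cases h1 : u.1 = v.1
  · rw [Finset.sum_eq_single u.1]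
    · simp only [h1, and_self, if_true]
      rw [← Finset.sum_div, hH.column_orthogonal]
      by_cases h2 : u.2 = v.2
      · rw [if_pos h2, if_pos (Prod.ext h1 h2), div_self hs]
      · rw [if_neg h2, if_neg fun h => h2 (congrArg Prod.snd h), zero_div]
    · intro b _ hb
      simp [hb]
    · simp
  · rw [if_neg fun h => h1 (congrArg Prod.fst h)]
    refine Finset.sum_eq_zero fun b _ => Finset.sum_eq_zero fun k _ => if_neg ?_
    rintro ⟨rfl, h⟩
    exact h1 h

/-- Blocks of different classes meet in exactly one cell, so an inner product between two bases is a
single term of modulus `1 / s = 1 / √(s ^ 2)`. -/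
theorem latinBasis_isMUBCollection (hL : IsMOLS L) (hH : IsCharacterTableWith H i₀ σ) :
    IsMUBCollection (latinBasis L H) where
  orthonormal := latinBasis_orthonormal hL hH
  span_eq_top c := by
    have : Nonempty (Fin s × Fin s) := ⟨(i₀, i₀)⟩
    exact (latinBasis_orthonormal hL hH c).linearIndependent.span_eq_top_of_card_eq_finrank
      (finrank_euclideanSpace).symm
  unbiased c d hcd u v := by
    obtain ⟨x, hx⟩ := (netBlock_bijective hL hcd).2 (u.1, v.1)
    rw [Prod.mk.injEq] at hx
    rw [inner_latinBasis, Finset.sum_eq_single x]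
    · rw [if_pos hx, norm_div, norm_mul, norm_star, hH.norm_eq_one, hH.norm_eq_one]
      simp
    · intro y _ hy
      refine if_neg fun h => hy ((netBlock_bijective hL hcd).1 ?_)
      exact Prod.ext (h.1.trans hx.1.symm) (h.2.trans hx.2.symm)
    · simp

/-- The permutation of the cells that moves the cell at position `k` of a block of the class `c`
to position `π k` of the same block. -/
noncomputable def netPerm (hL : IsMOLS L) (c : Fin 2 ⊕ Fin w) (π : Equiv.Perm (Fin s)) :
    Equiv.Perm (Fin s × Fin s) :=
  (Equiv.ofBijective _ (netPos_bijective hL c)).symm.permCongr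
    (Equiv.prodCongr (Equiv.refl _) π)

theorem netPerm_apply (hL : IsMOLS L) (c : Fin 2 ⊕ Fin w) (π : Equiv.Perm (Fin s))
    (x : Fin s × Fin s) : netBlock L c (netPerm hL c π x) = netBlock L c x ∧
      netPos c (netPerm hL c π x) = π (netPos c x) := by
  have h := (Equiv.ofBijective _ (netPos_bijective hL c)).apply_symm_apply
    (netBlock L c x, π (netPos c x))
  exact ⟨congrArg Prod.fst h, congrArg Prod.snd h⟩

theorem net_ext (hL : IsMOLS L) {c : Fin 2 ⊕ Fin w} {x y : Fin s × Fin s}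
    (h1 : netBlock L c x = netBlock L c y) (h2 : netPos c x = netPos c y) : x = y :=
  (netPos_bijective hL c).1 (Prod.ext h1 h2)

/-- Multiplication by the row `i` of a character table, as a permutation of the rows. -/
noncomputable def rowPerm (hH : IsCharacterTableWith H i₀ σ) (i : Fin s) : Equiv.Perm (Fin s) :=
  Equiv.ofBijective (σ i) (Finite.injective_iff_bijective.1 (hH.mul_injective i))

/-- The monomial matrix, diagonal in the Latin basis of the class `c`, that acts on the blocks by
the character `z.1` and on the positions by translation with the character `z.2`. -/
noncomputable def latinClassMatrix (hL : IsMOLS L) (hH : IsCharacterTableWith H i₀ σ) (c : Fin 2 ⊕ Fin w)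
    (z : Fin s × Fin s) : Matrix (Fin s × Fin s) (Fin s × Fin s) ℂ :=
  monomialMatrix (netPerm hL c (rowPerm hH z.2)) fun x => H z.1 (netBlock L c x)

theorem latinClassMatrix_mulVec (hL : IsMOLS L) (hH : IsCharacterTableWith H i₀ σ)
    (c : Fin 2 ⊕ Fin w) (z u : Fin s × Fin s) :
    latinClassMatrix hL hH c z *ᵥ (latinBasis L H c u).ofLp =
      (H z.1 u.1 * H z.2 u.2) • (latinBasis L H c u).ofLp := by
  funext x
  rw [latinClassMatrix, monomialMatrix_mulVec]
  simp only [latinBasis, netPerm_apply, Pi.smul_apply, smul_eq_mul]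
  split_ifs with h
  · rw [h, show rowPerm hH z.2 (netPos c x) = σ z.2 (netPos c x) from rfl, hH.mul_row]
    ring
  · simp

theorem latinClassMatrix_trivial (hL : IsMOLS L) (hH : IsCharacterTableWith H i₀ σ)
    (c : Fin 2 ⊕ Fin w) : latinClassMatrix hL hH c (i₀, i₀) = 1 := by
  have h : netPerm hL c (rowPerm hH i₀) = Equiv.refl _ := by
    ext1 x
    obtain ⟨h1, h2⟩ := netPerm_apply hL c (rowPerm hH i₀) x
    exact net_ext hL h1 (h2.trans (hH.trivial_mul _))
  ext x y
  simp [latinClassMatrix, h, monomialMatrix, hH.trivial_row, Matrix.one_apply, eq_comm]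

theorem latinClassMatrix_commute (hL : IsMOLS L) (hH : IsCharacterTableWith H i₀ σ)
    (c : Fin 2 ⊕ Fin w) (z z' : Fin s × Fin s) :
    latinClassMatrix hL hH c z * latinClassMatrix hL hH c z' =
      latinClassMatrix hL hH c z' * latinClassMatrix hL hH c z := by
  rw [latinClassMatrix, latinClassMatrix, monomialMatrix_mul, monomialMatrix_mul]
  congr 1
  · ext1 x
    refine net_ext hL (c := c) ?_ ?_
    · simp only [Equiv.trans_apply, netPerm_apply]
    · simp only [Equiv.trans_apply, netPerm_apply]
      exact hH.mul_left_comm _ _ _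
  · funext x
    simp only [netPerm_apply]
    ring

/-- Different translations never agree on a cell; for equal translations the trace reduces to
orthogonality of two characters on the block labels. -/
theorem latinClassMatrix_trace_same (hL : IsMOLS L) (hH : IsCharacterTableWith H i₀ σ)
    (c : Fin 2 ⊕ Fin w) {z z' : Fin s × Fin s} (hz : z ≠ z') :
    ((latinClassMatrix hL hH c z)ᴴ * latinClassMatrix hL hH c z').trace = 0 := by
  rw [latinClassMatrix, latinClassMatrix, monomialMatrix_trace_conjTranspose_mul]
  by_cases h2 : z.2 = z'.2
  · have h1 : z.1 ≠ z'.1 := fun h1 => hz (Prod.ext h1 h2)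
    simp only [h2, if_true]
    rw [(netPos_bijective hL c).sum_comp fun y : Fin s × Fin s => star (H z.1 y.1) * H z'.1 y.1,
      Fintype.sum_prod_type_right]
    simp only [hH.row_orthogonal _ _ h1, Finset.sum_const_zero]
  · refine Finset.sum_eq_zero fun x _ => if_neg fun h => h2 ?_
    have h3 := congrArg (netPos c) h
    rw [(netPerm_apply hL c _ x).2, (netPerm_apply hL c _ x).2] at h3
    exact hH.mul_left_injective h3

/-- If the two permutations agree at a cell, the image shares both blocks with that cell and so
equals it, which makes both translations trivial. In that case both matrices are diagonal, and the
trace factors into two character sums over the two block labels, one of which vanishes. -/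
theorem latinClassMatrix_trace_of_ne (hL : IsMOLS L) (hH : IsCharacterTableWith H i₀ σ)
    {c d : Fin 2 ⊕ Fin w} (hcd : c ≠ d) {z z' : Fin s × Fin s}
    (hz : z ≠ (i₀, i₀) ∨ z' ≠ (i₀, i₀)) :
    ((latinClassMatrix hL hH c z)ᴴ * latinClassMatrix hL hH d z').trace = 0 := by
  rw [latinClassMatrix, latinClassMatrix, monomialMatrix_trace_conjTranspose_mul]
  by_cases h2 : z.2 = i₀ ∧ z'.2 = i₀
  · have h1 : z.1 ≠ i₀ ∨ z'.1 ≠ i₀ := by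
      rcases hz with h | h
      · exact Or.inl fun h1 => h (Prod.ext h1 h2.1)
      · exact Or.inr fun h1 => h (Prod.ext h1 h2.2)
    have h3 : ∀ x, netPerm hL c (rowPerm hH z.2) x = netPerm hL d (rowPerm hH z'.2) x := by
      intro x
      trans x
      · obtain ⟨h4, h5⟩ := netPerm_apply hL c (rowPerm hH z.2) x
        refine net_ext hL h4 (h5.trans ?_)
        rw [h2.1]
        exact hH.trivial_mul _
      · obtain ⟨h4, h5⟩ := netPerm_apply hL d (rowPerm hH z'.2) x
        refine (net_ext hL h4 (h5.trans ?_)).symm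
        rw [h2.2]
        exact hH.trivial_mul _
    simp only [h3, if_true]
    rw [(netBlock_bijective hL hcd).sum_comp fun y : Fin s × Fin s =>
      star (H z.1 y.1) * H z'.1 y.2, Fintype.sum_prod_type]
    simp only [← Finset.mul_sum, ← Finset.sum_mul, ← star_sum]
    rcases h1 with h1 | h1
    · rw [hH.sum_eq_zero h1, star_zero, zero_mul]
    · rw [hH.sum_eq_zero h1, mul_zero]
  · refine Finset.sum_eq_zero fun x _ => if_neg fun h => h2 ?_
    obtain ⟨h4, h5⟩ := netPerm_apply hL c (rowPerm hH z.2) x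
    obtain ⟨h6, h7⟩ := netPerm_apply hL d (rowPerm hH z'.2) x
    have hx : netPerm hL c (rowPerm hH z.2) x = x :=
      (netBlock_bijective hL hcd).1 (Prod.ext h4 (by rw [h]; exact h6))
    rw [hx] at h5
    rw [← h, hx] at h7
    exact ⟨hH.mul_left_injective (h5.symm.trans (hH.trivial_mul _).symm),
      hH.mul_left_injective (h7.symm.trans (hH.trivial_mul _).symm)⟩

theorem latinClassMatrix_mem_unitaryGroup (hL : IsMOLS L) (hH : IsCharacterTableWith H i₀ σ)
    (c : Fin 2 ⊕ Fin w) (z : Fin s × Fin s) :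
    latinClassMatrix hL hH c z ∈ Matrix.unitaryGroup (Fin s × Fin s) ℂ :=
  monomialMatrix_mem_unitaryGroup _ fun _ => hH.star_mul_self _ _

theorem latinClassMatrix_trace_self_ne_zero (hL : IsMOLS L) (hH : IsCharacterTableWith H i₀ σ)
    (c : Fin 2 ⊕ Fin w) (z : Fin s × Fin s) :
    ((latinClassMatrix hL hH c z)ᴴ * latinClassMatrix hL hH c z).trace ≠ 0 := by
  have : Nonempty (Fin s × Fin s) := ⟨z⟩
  rw [← Matrix.star_eq_conjTranspose,
    (Matrix.mem_unitaryGroup_iff').1 (latinClassMatrix_mem_unitaryGroup hL hH c z),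
    Matrix.trace_one]
  exact Nat.cast_ne_zero.2 Fintype.card_ne_zero

theorem latinClassMatrix_injective (hL : IsMOLS L) (hH : IsCharacterTableWith H i₀ σ)
    (c : Fin 2 ⊕ Fin w) : Function.Injective (latinClassMatrix hL hH c) := by
  intro z z' h
  by_contra hne
  have h1 := latinClassMatrix_trace_same hL hH c hne
  rw [← h] at h1
  exact latinClassMatrix_trace_self_ne_zero hL hH c z h1

theorem latinClassMatrix_isMaxCommutingClasses (hL : IsMOLS L)
    (hH : IsCharacterTableWith H i₀ σ) :
    IsMaxCommutingClasses fun c => Set.range (latinClassMatrix hL hH c) where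
  unitary := by
    rintro c _ ⟨z, rfl⟩
    exact latinClassMatrix_mem_unitaryGroup hL hH c z
  one_mem c := ⟨_, latinClassMatrix_trivial hL hH c⟩
  ncard_eq c := by
    rw [← Nat.card_coe_set_eq, Nat.card_range_of_injective (latinClassMatrix_injective hL hH c),
      Nat.card_eq_fintype_card]
  commute := by
    rintro c _ ⟨z, rfl⟩ _ ⟨z', rfl⟩
    exact latinClassMatrix_commute hL hH c z z'
  inter_eq := by
    intro c d hcd
    refine Set.Subset.antisymm ?_ ?_
    · rintro _ ⟨⟨z, rfl⟩, z', h⟩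
      by_contra hne
      have hz : z ≠ (i₀, i₀) := by
        rintro rfl
        exact hne (latinClassMatrix_trivial hL hH c)
      have h1 := latinClassMatrix_trace_of_ne hL hH hcd (z' := z') (Or.inl hz)
      rw [h] at h1
      exact latinClassMatrix_trace_self_ne_zero hL hH c z h1
    · rintro _ rfl
      exact ⟨⟨_, latinClassMatrix_trivial hL hH c⟩, ⟨_, latinClassMatrix_trivial hL hH d⟩⟩
  orthogonal := by
    rintro c d _ ⟨z, rfl⟩ _ ⟨z', rfl⟩ hne
    by_cases hcd : c = d
    · subst hcd
      exact latinClassMatrix_trace_same hL hH c fun h => hne (by rw [h])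
    · refine latinClassMatrix_trace_of_ne hL hH hcd ?_
      by_contra! h
      rw [h.1, h.2, latinClassMatrix_trivial, latinClassMatrix_trivial] at hne
      exact hne rfl

theorem exists_monomial_classes (hL : IsMOLS L) (hH : IsCharacterTableWith H i₀ σ) :
    ∃ C : Fin 2 ⊕ Fin w → Set (Matrix (Fin s × Fin s) (Fin s × Fin s) ℂ),
      IsMaxCommutingClasses C ∧ ClassesCorrespond C (latinBasis L H) ∧
        ∀ k, ∀ U ∈ C k, IsMonomialMatrix U := by
  refine ⟨_, latinClassMatrix_isMaxCommutingClasses hL hH, ?_, ?_⟩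
  · rintro c _ ⟨z, rfl⟩ u
    exact ⟨_, latinClassMatrix_mulVec hL hH c z u⟩
  · rintro c _ ⟨z, rfl⟩
    exact isMonomialMatrix_monomialMatrix _ fun x => hH.ne_zero _ _

end Latin

/-! ### The main theorem. -/

theorem mainTheorem8 :
    (∀ (X : Type) [Fintype X] [DecidableEq X], 2 ≤ Fintype.card X →
      ∀ N : Set (Matrix X X ℂ), IsNiceErrorBasis N →
      ∀ (κ : Type) [Fintype κ] (C : κ → Set (Matrix X X ℂ)),
        IsMaxCommutingClasses C → (∀ k, C k ⊆ N) →
        Fintype.card κ ≤ minPrimePower (Fintype.card X) + 1) ∧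
    {n : ℕ | ∃ s : ℕ, 2 ≤ s ∧ n = s ^ 2 ∧
      ∃ (w : ℕ) (L : Fin w → Fin s → Fin s → Fin s), IsMOLS L ∧
        minPrimePower n + 1 < w + 2 ∧
        (∃ H : Matrix (Fin s) (Fin s) ℂ, IsAbelianCharacterTable H) ∧
        ∀ H : Matrix (Fin s) (Fin s) ℂ, IsAbelianCharacterTable H →
          IsMUBCollection (latinBasis L H) ∧
          (∃ C : Fin 2 ⊕ Fin w → Set (Matrix (Fin s × Fin s) (Fin s × Fin s) ℂ),
            IsMaxCommutingClasses C ∧ ClassesCorrespond C (latinBasis L H) ∧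
            ∀ k, ∀ U ∈ C k, IsMonomialMatrix U) ∧
          ∀ C : Fin 2 ⊕ Fin w → Set (Matrix (Fin s × Fin s) (Fin s × Fin s) ℂ),
            IsMaxCommutingClasses C → ClassesCorrespond C (latinBasis L H) →
            ¬ ∃ N : Set (Matrix (Fin s × Fin s) (Fin s × Fin s) ℂ),
              IsNiceErrorBasis N ∧ ∀ k, C k ⊆ N}.Infinite := by
  refine ⟨fun X _ _ hX N hN κ _ C hC hCN => hC.card_le_of_subset_niceErrorBasis hX hN hCN, ?_⟩
  -- The factor `6 * t + 1` is prime to `2` and `3`, which gives four squares of that order and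
  -- keeps the power of `2` in `n` at `4`.
  refine Set.infinite_of_injective_forall_mem (f := fun t : ℕ => (26 * (6 * t + 1)) ^ 2) ?_ ?_
  · intro t t' h
    have := Nat.pow_left_injective two_ne_zero h
    omega
  intro t
  have hq : ∀ k, 0 < k → k < 5 → k.Coprime (6 * t + 1) := by
    have h2 : Nat.Coprime 2 (6 * t + 1) := (Nat.prime_two.coprime_iff_not_dvd).2 (by omega)
    intro k h0 h5
    interval_cases k
    · exact Nat.coprime_one_left _
    · exact h2
    · exact (Nat.prime_three.coprime_iff_not_dvd).2 (by omega)
    · exact h2.pow_left 2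
  obtain ⟨L, hL⟩ := exists_isMOLS_four (6 * t + 1) hq
  have hm := minPrimePower_sq_le_four t
  refine ⟨26 * (6 * t + 1), by omega, rfl, 4, L, hL, by omega,
    exists_isAbelianCharacterTable _, fun H hH => ?_⟩
  obtain ⟨i₀, σ, hT⟩ := hH.exists_isCharacterTableWith
  refine ⟨latinBasis_isMUBCollection hL hT, exists_monomial_classes hL hT, ?_⟩
  rintro C hC - ⟨N, hN, hCN⟩
  have hcard : Fintype.card (Fin (26 * (6 * t + 1)) × Fin (26 * (6 * t + 1)))
      = (26 * (6 * t + 1)) ^ 2 := by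
    rw [Fintype.card_prod, Fintype.card_fin, sq]
  -- The bound of part (a) would give `6 ≤ 4 + 1`.
  have h := hC.card_le_of_subset_niceErrorBasis 
    (by rw [hcard]; exact le_trans (by omega) (Nat.le_self_pow two_ne_zero _)) hN hCN
  rw [hcard, Fintype.card_sum, Fintype.card_fin, Fintype.card_fin] at h
  omega
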